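/- Let $S$ be a monoid possessing a group $S^{-1}S$ of left quotients, and let $\phi\colon S\to\mathrm{End}(R)$, $s\mapsto\phi_s$, be an action of $S$ by injective unital endomorphisms on a semiprime left Goldie ring $R$ (associative, with unity). For a ring $B$ with an action of $S$ by injective endomorphisms, an $S$-Cohn-Jordan extension $A(B;S)$ of $B$ is an over-ring of $B$ to which the action of $S$ extends as an action by automorphisms, such that every element has the form $\phi_s^{-1}(b)$ with $s\in S$, $b\in B$. Let $A=A(R;S)$ be an $S$-Cohn-Jordan extension of $R$. Then $R$ has a classical left quotient ring $Q(R)$ (an over-ring of $R$ in which all regular elements of $R$ are invertible and all of whose elements have the form $c^{-1}r$ with $c,r\in R$, $c$ regular), the action of $S$ extends to $Q(R)$, and there is an $S$-Cohn-Jordan extension $A(Q(R);S)$ of $Q(R)$ that contains $A$ $S$-equivariantly, so that $Q(R)$ and $A$ are over-rings of $R$ inside the common over-ring $A(Q(R);S)$. Moreover, for every such realization, the following conditions are equivalent: 1. $Q(R)\cap A=R$ (intersection inside $A(Q(R);S)$); 2. $Rc=\overline{Rc}$ and $cR=\overline{cR}$ for every regular element $c\in R$; 3. $cR=\overline{cR}$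 for every regular element $c\in R$; 4. for all $a\in A$ and all regular $c\in R$, if $ca\in R$ then $a\in R$. Here $\overline{X}=AX\cap R$ for a left ideal $X$ of $R$, and $\overline{X}=XA\cap R$ for a right ideal $X$ of $R$, where $AX$ and $XA$ are the additive subgroups generated by the products. -/

import Mathlib

universe u v w u' w'

namespace CohnJordan

/-- A monoid `S` possesses a group of left quotients: it embeds into a group all of whose elements
have the form `s⁻¹ t` with `s, t ∈ S`. -/
def HasLeftQuotientGroup (S : Type v) [Monoid S] : Prop :=
  ∃ (G : Type v) (_ : Group G) (e : S →* G), Function.Injective e ∧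
    ∀ g : G, ∃ s t : S, g = (e s)⁻¹ * e t

/-- A ring is semiprime if `a R a = 0` implies `a = 0`. -/
def IsSemiprimeRing (R : Type*) [Ring R] : Prop :=
  ∀ a : R, (∀ r : R, a * r * a = 0) → a = 0

/-- The left annihilator `{r | r x = 0 for all x ∈ X}`, a left ideal. -/
def leftAnnihilator {R : Type*} [Ring R] (X : Set R) : Ideal R where
  carrier := {r | ∀ x ∈ X, r * x = 0}
  zero_mem' := fun x _ => zero_mul x
  add_mem' := fun {a b} ha hb x hx => by rw [add_mul, ha x hx, hb x hx, add_zero]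
  smul_mem' := fun r a ha x hx => by rw [smul_eq_mul, mul_assoc, ha x hx, mul_zero]

/-- A ring is left Goldie if it has the ascending chain condition on left annihilators and finite
left uniform dimension, that is, it contains no infinite direct sum of nonzero left ideals. -/
structure IsLeftGoldie (R : Type*) [Ring R] : Prop where
  acc_leftAnnihilator : WellFoundedGT {I : Ideal R // ∃ X : Set R, I = leftAnnihilator X}
  finite_uniformDim : ¬ ∃ f : ℕ → Ideal R, iSupIndep f ∧ ∀ n, f n ≠ ⊥

/-- `k : R → Q` makes `Q` a classical left quotient ring of `R`: it is injective, regular elements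
of `R` become invertible, and every element of `Q` has the form `c⁻¹ r` with `c, r ∈ R` and `c`
regular. -/
structure IsClassicalLeftQuotientRing {R Q : Type*} [Ring R] [Ring Q] (k : R →+* Q) : Prop where
  injective : Function.Injective k
  isUnit : ∀ c : R, IsRegular c → IsUnit (k c)
  exists_eq : ∀ q : Q, ∃ c r : R, IsRegular c ∧ k c * q = k r

/-- Let `S` act on `R` by endomorphisms `φ`. An over-ring `i : R → A` with an action `α` of `S` by
automorphisms is an `S`-Cohn-Jordan extension of `R` if `α` extends `φ` and every element of `A`
has the form `α_s⁻¹(b)` with `s ∈ S` and `b ∈ R`. -/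
structure IsCohnJordanExtension {S R A : Type*} [Monoid S] [Ring R] [Ring A]
    (φ : S →* (R →+* R)) (i : R →+* A) (α : S →* RingAut A) : Prop where
  injective : Function.Injective i
  extends_action : ∀ (s : S) (r : R), α s (i r) = i (φ s r)
  exists_eq : ∀ a : A, ∃ (s : S) (b : R), a = (α s).symm (i b)

/-- A realization of `A(Q(R); S)` containing both `Q(R)` and `A = A(R; S)` as over-rings of `R`:
`k : R → Q` is a classical left quotient ring of `R`, `ψ` is an action of `S` on `Q` extending `φ`,
`l : Q → E` with the action `ε` is an `S`-Cohn-Jordan extension of `Q`, and `j : A → E` is an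
`S`-equivariant embedding which agrees with `l ∘ k` on `R`. -/
structure IsCommonOverring {S R A Q E : Type*} [Monoid S] [Ring R] [Ring A] [Ring Q] [Ring E]
    (φ : S →* (R →+* R)) (i : R →+* A) (α : S →* RingAut A)
    (k : R →+* Q) (ψ : S →* (Q →+* Q)) (l : Q →+* E) (ε : S →* RingAut E) (j : A →+* E) :
    Prop where
  quotient : IsClassicalLeftQuotientRing k
  extends_action : ∀ (s : S) (r : R), ψ s (k r) = k (φ s r)
  cohnJordan : IsCohnJordanExtension ψ l ε
  injective : Function.Injective j
  agree : ∀ r : R, j (i r) = l (k r)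
  equivariant : ∀ (s : S) (a : A), j (α s a) = ε s (j a)

/-- The closure `AX ∩ R` of a left ideal `X` of `R` (with `i : R → A`). -/
def leftClosure {R A : Type*} [Ring R] [Ring A] (i : R →+* A) (X : Set R) : Set R :=
  {r | i r ∈ AddSubgroup.closure {y : A | ∃ a : A, ∃ x ∈ X, y = a * i x}}

/-- The closure `XA ∩ R` of a right ideal `X` of `R` (with `i : R → A`). -/
def rightClosure {R A : Type*} [Ring R] [Ring A] (i : R →+* A) (X : Set R) : Set R :=
  {r | i r ∈ AddSubgroup.closure {y : A | ∃ x ∈ X, ∃ a : A, y = i x * a}}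

/-- The principal left ideal `Rc`. -/
def principalLeft {R : Type*} [Ring R] (c : R) : Set R := {y | ∃ r : R, y = r * c}

/-- The principal right ideal `cR`. -/
def principalRight {R : Type*} [Ring R] (c : R) : Set R := {y | ∃ r : R, y = c * r}

end CohnJordan

/-!
The existence half is Goldie's theorem together with the fact that an injective endomorphism `φ` of
a semiprime left Goldie ring `R` preserves regular elements. Finite uniform dimension is used as a
descending chain condition on left ideals modulo essential inclusions
(`IsLeftGoldie.wellFounded_notEssentialIn`). It shows that `Rc` is essential when `l(c) = 0`
(`IsLeftGoldie.isEssential_span`) and that essential left ideals contain regular elements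
(`IsLeftGoldie.exists_isRegular_mem`); here `l(x)` is the left annihilator of `x`. The left Ore
condition follows. That `φ` preserves regular elements (`IsLeftGoldie.isRegular_map`) needs no
quotient ring: for the elements `x₀ = 1`, `xₙ₊₁ = φ(c xₙ)` the ascending chain `l(xₙ)` stabilizes,
and each equality in it propagates down to `l(φ(c)) = 0`.

Since `S` is left Ore, `A` is the directed union of the subrings `α_m⁻¹(R)`, all isomorphic to `R`.
Hence `A` too satisfies the left Ore condition with respect to its regular elements, and its ring of
left fractions is an `S`-Cohn-Jordan extension of `Q(R)` (`exists_isCommonOverring`).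

The equivalence of the four conditions (`IsCommonOverring.tfae`) takes place inside a realization,
where a regular `c ∈ R` is invertible: `AX` and `XA` for `X = Rc`, `cR` are just `Ac` and `cA`, and
an `a ∈ A` with `ca ∈ R` or `ac ∈ R` lies in `Q(R)`.
-/

namespace CohnJordan

/-! ### Essential left ideals -/

section Goldie

variable {R : Type*} [Ring R]

/-- A left ideal is essential if it meets every nonzero left ideal nontrivially; the elementwise form
of this is used: every nonzero `x` has a nonzero left multiple in `I`. -/
def IsEssential (I : Ideal R) : Prop :=
  ∀ x : R, x ≠ 0 → ∃ r : R, r * x ∈ I ∧ r * x ≠ 0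

theorem mem_leftAnnihilator_singleton {x r : R} : r ∈ leftAnnihilator {x} ↔ r * x = 0 :=
  ⟨fun h => h x rfl, fun h y hy => by rw [Set.mem_singleton_iff.1 hy, h]⟩

theorem IsEssential.mono {I J : Ideal R} (hI : IsEssential I) (hIJ : I ≤ J) : IsEssential J :=
  fun x hx => (hI x hx).imp fun _ h => ⟨hIJ h.1, h.2⟩

/-- The left ideal `(I : a) = {r | r a ∈ I}`. -/
def colonRight (I : Ideal R) (a : R) : Ideal R :=
  Submodule.comap (LinearMap.toSpanSingleton R R a) I

theorem mem_colonRight {I : Ideal R} {a r : R} : r ∈ colonRight I a ↔ r * a ∈ I := Iff.rfl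

theorem IsEssential.colonRight {I : Ideal R} (hI : IsEssential I) (a : R) :
    IsEssential (colonRight I a) := by
  intro x hx
  by_cases hxa : x * a = 0
  · exact ⟨1, by rw [mem_colonRight, one_mul, hxa]; exact I.zero_mem, by rwa [one_mul]⟩
  · obtain ⟨r, hr, hne⟩ := hI _ hxa
    refine ⟨r, by rwa [mem_colonRight, mul_assoc], fun h => hne ?_⟩
    rw [← mul_assoc, h, zero_mul]

/-- The relation "`L' ≤ L` and `L'` is not essential in `L`": some nonzero `b ∈ L` has no nonzero
left multiple in `L'`. -/
def NotEssentialIn (L' L : Ideal R) : Prop :=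
  L' ≤ L ∧ ∃ b ∈ L, b ≠ 0 ∧ ∀ r : R, r * b ∈ L' → r * b = 0

/-- A finite sum of terms `v i ∈ B i`, with `B i ≤ L i` and `B i ⊓ L (i + 1) = ⊥` for a descending
chain `L`, can only vanish termwise: the term of least index lies in the next member of the chain. -/
theorem iSupIndep_of_antitone {L B : ℕ → Ideal R} (hL : Antitone L) (hB : ∀ n, B n ≤ L n)
    (h : ∀ n, ∀ x ∈ B n, x ∈ L (n + 1) → x = 0) : iSupIndep B := by
  classical
  rw [iSupIndep_iff_finsetSum_eq_zero_imp_eq_zero]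
  intro s v hv hsum i
  induction i using Nat.strong_induction_on with
  | _ i ih =>
    intro hi
    refine h i _ (hv i hi) ?_
    have hrest : ∑ j ∈ s.erase i, v j ∈ L (i + 1) := by
      refine Submodule.sum_mem _ fun j hj => ?_
      obtain ⟨hji, hjs⟩ := Finset.mem_erase.1 hj
      rcases lt_or_gt_of_ne hji with hlt | hgt
      · rw [ih j hlt hjs]; exact Submodule.zero_mem _
      · exact hL hgt (hB j (hv j hjs))
    rw [eq_neg_of_add_eq_zero_left ((Finset.add_sum_erase s v hi).trans hsum)]
    exact Submodule.neg_mem _ hrest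

/-- Finite uniform dimension is a descending chain condition modulo essential inclusions. -/
theorem IsLeftGoldie.wellFounded_notEssentialIn (hG : IsLeftGoldie R) :
    WellFounded (NotEssentialIn (R := R)) := by
  rw [wellFounded_iff_isEmpty_descending_chain]
  refine ⟨fun ⟨L, hL⟩ => hG.finite_uniformDim ?_⟩
  choose hle b hbL hb0 hb using hL
  refine ⟨fun n => Ideal.span {b n}, iSupIndep_of_antitone (L := L) (antitone_nat_of_succ_le hle)
    (fun n => (Ideal.span_singleton_le_iff_mem _).2 (hbL n)) ?_, fun n => ?_⟩
  · intro n x hx hxL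
    obtain ⟨r, rfl⟩ := Ideal.mem_span_singleton'.1 hx
    exact hb n r hxL
  · rw [Ne, Ideal.span_singleton_eq_bot]
    exact hb0 n

/-- If `x` has no nonzero left multiple in `Rc`, where `c` has zero left annihilator, then the left
ideals `R x cⁿ` form an infinite direct sum. -/
theorem IsLeftGoldie.isEssential_span (hG : IsLeftGoldie R) {c : R}
    (hc : ∀ r : R, r * c = 0 → r = 0) : IsEssential (Ideal.span {c}) := by
  intro x hx
  by_contra! hcon
  have hcn : ∀ (n : ℕ) (r : R), r * c ^ n = 0 → r = 0 := by
    intro n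
    induction n with
    | zero => intro r hr; rwa [pow_zero, mul_one] at hr
    | succ n ih => intro r hr; exact ih r (hc _ (by rwa [mul_assoc, ← pow_succ]))
  refine (wellFounded_iff_isEmpty_descending_chain.1 hG.wellFounded_notEssentialIn).false
    ⟨fun n => Ideal.span {c ^ n}, fun n => ⟨?_, x * c ^ n, ?_, ?_, ?_⟩⟩
  · rw [Ideal.span_singleton_le_iff_mem, pow_succ']
    exact Ideal.mul_mem_left _ _ (Ideal.mem_span_singleton_self _)
  · exact Ideal.mul_mem_left _ _ (Ideal.mem_span_singleton_self _)
  · exact fun h => hx (hcn n x h)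
  · intro r hr
    obtain ⟨t, ht⟩ := Ideal.mem_span_singleton'.1 hr
    have h0 : t * c - r * x = 0 := hcn n _ (by
      rw [sub_mul, mul_assoc, ← pow_succ', ht, ← mul_assoc, sub_self])
    have := hcon r (Ideal.mem_span_singleton'.2 ⟨t, sub_eq_zero.1 h0⟩)
    rw [← mul_assoc, this, zero_mul]

/-- The ascending chain condition on left annihilators of elements, as a maximality principle. -/
theorem IsLeftGoldie.exists_maximal (hG : IsLeftGoldie R) (p : R → Prop) (hp : ∃ x, p x) :
    ∃ x, p x ∧ ∀ y, p y → (∀ t : R, t * x = 0 → t * y = 0) → ∀ t : R, t * y = 0 → t * x = 0 := by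
  have := hG.acc_leftAnnihilator
  let f : R → {I : Ideal R // ∃ X : Set R, I = leftAnnihilator X} :=
    fun x => ⟨leftAnnihilator {x}, {x}, rfl⟩
  obtain ⟨x, hx, hmax⟩ := WellFounded.has_min
    (InvImage.wf f (wellFounded_gt (α := {I : Ideal R // ∃ X : Set R, I = leftAnnihilator X})))
    {x | p x} hp
  refine ⟨x, hx, fun y hy hle => ?_⟩
  have hle' : f x ≤ f y := fun t ht =>
    mem_leftAnnihilator_singleton.2 (hle t (mem_leftAnnihilator_singleton.1 ht))
  have hge : f y ≤ f x := by
    by_contra hn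
    exact hmax y hy (lt_of_le_not_ge hle' hn)
  exact fun t ht =>
    mem_leftAnnihilator_singleton.1 (hge (mem_leftAnnihilator_singleton.2 ht))

/-! ### The singular ideal and regular elements of a semiprime left Goldie ring -/

/-- The left singular ideal vanishes. A nonzero singular `z` with maximal left annihilator satisfies
`z y = 0` for every singular `y`, since `l(z) < l(z y)` by essentiality of `l(y)`; hence `z R z = 0`.
-/
theorem IsLeftGoldie.eq_zero_of_isEssential_leftAnnihilator (hG : IsLeftGoldie R)
    (hsp : IsSemiprimeRing R) {z : R} (hz : IsEssential (leftAnnihilator {z})) : z = 0 := by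
  by_contra hne
  obtain ⟨z, ⟨hz, hne⟩, hmax⟩ := hG.exists_maximal
    (fun x => IsEssential (leftAnnihilator {x}) ∧ x ≠ 0) ⟨z, hz, hne⟩
  refine hne (hsp z fun r => ?_)
  by_contra hzrz
  have hrz : IsEssential (leftAnnihilator {r * z}) := (hz.colonRight r).mono fun t ht => by
    rw [mem_colonRight, mem_leftAnnihilator_singleton] at ht
    rwa [mem_leftAnnihilator_singleton, ← mul_assoc]
  obtain ⟨t, ht, htz⟩ := hrz z hne
  have hle : ∀ t : R, t * z = 0 → t * (z * r * z) = 0 := fun t ht => by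
    rw [← mul_assoc, ← mul_assoc, ht, zero_mul, zero_mul]
  refine htz (hmax (z * r * z) ⟨hz.mono fun t ht => ?_, hzrz⟩ hle t ?_)
  · exact mem_leftAnnihilator_singleton.2 (hle t (mem_leftAnnihilator_singleton.1 ht))
  · rw [mem_leftAnnihilator_singleton] at ht
    rw [← ht]; simp only [mul_assoc]

theorem isRegular_iff_mul_eq_zero {c : R} :
    IsRegular c ↔ (∀ r : R, c * r = 0 → r = 0) ∧ ∀ r : R, r * c = 0 → r = 0 := by
  rw [isRegular_iff, isLeftRegular_iff_right_eq_zero_of_mul, isRightRegular_iff_left_eq_zero_of_mul]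

/-- An essential left ideal annihilates no nonzero element. -/
theorem IsLeftGoldie.eq_zero_of_essential_mul (hG : IsLeftGoldie R)
    (hsp : IsSemiprimeRing R) {I : Ideal R} (hI : IsEssential I) {x : R}
    (h : ∀ r ∈ I, r * x = 0) : x = 0 :=
  hG.eq_zero_of_isEssential_leftAnnihilator hsp
    (hI.mono fun r hr => mem_leftAnnihilator_singleton.2 (h r hr))

theorem IsLeftGoldie.isRegular_of_left (hG : IsLeftGoldie R) (hsp : IsSemiprimeRing R) {c : R}
    (hc : ∀ r : R, r * c = 0 → r = 0) : IsRegular c := by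
  refine isRegular_iff_mul_eq_zero.2 ⟨fun x hx => ?_, hc⟩
  refine hG.eq_zero_of_essential_mul hsp (hG.isEssential_span hc) fun r hr => ?_
  obtain ⟨t, rfl⟩ := Ideal.mem_span_singleton'.1 hr
  rw [mul_assoc, hx, mul_zero]

/-- A nonzero left ideal contains a nonzero `a` with `l(a²) = l(a)`; in particular it is not nil. -/
theorem IsLeftGoldie.exists_mul_self_mul_eq_zero (hG : IsLeftGoldie R) (hsp : IsSemiprimeRing R)
    {I : Ideal R} (hI : ∃ x ∈ I, x ≠ 0) :
    ∃ a ∈ I, a ≠ 0 ∧ ∀ t : R, t * a * a = 0 → t * a = 0 := by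
  obtain ⟨b, ⟨hbI, hb0⟩, hmax⟩ := hG.exists_maximal (fun x => x ∈ I ∧ x ≠ 0) hI
  -- `l(b r b) = l(b)` whenever `b r b ≠ 0`, so that `a = r b` has the required property.
  obtain ⟨r, hr⟩ : ∃ r, b * r * b ≠ 0 := by
    by_contra! hcon
    exact hb0 (hsp b hcon)
  refine ⟨r * b, I.mul_mem_left r hbI, fun h => hr (by rw [mul_assoc, h, mul_zero]), fun t ht => ?_⟩
  rw [← mul_assoc]
  refine hmax (b * r * b) ⟨I.mul_mem_left _ hbI, hr⟩ (fun s hs => ?_) (t * r) ?_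
  · rw [← mul_assoc, ← mul_assoc, hs, zero_mul, zero_mul]
  · rw [← ht]; simp only [mul_assoc]

/-- Goldie's lemma: an essential left ideal `I` contains a regular element. Among the `c ∈ I` with
`l(c²) = l(c)`, take one whose annihilator is minimal modulo essential inclusions. If `I ∩ l(c)`
were nonzero, it would contain a nonzero `a` with `l(a²) = l(a)`; as `a c = 0`, the element `c + a`
has annihilator `l(c) ∩ l(a)`, which does not meet `R a ⊆ l(c)`. -/
theorem IsLeftGoldie.exists_isRegular_mem (hG : IsLeftGoldie R) (hsp : IsSemiprimeRing R)
    {I : Ideal R} (hI : IsEssential I) : ∃ c ∈ I, IsRegular c := by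
  obtain ⟨c, ⟨hcI, hc⟩, hmin⟩ := WellFounded.has_min
    (InvImage.wf (fun x : R => leftAnnihilator {x}) hG.wellFounded_notEssentialIn)
    {c | c ∈ I ∧ ∀ t : R, t * c * c = 0 → t * c = 0} ⟨0, I.zero_mem, by simp⟩
  refine ⟨c, hcI, hG.isRegular_of_left hsp fun x hxc => ?_⟩
  by_contra hx
  have hne : ∃ x ∈ I ⊓ leftAnnihilator {c}, x ≠ 0 := by
    obtain ⟨r, hrI, hr0⟩ := hI x hx
    exact ⟨r * x, ⟨hrI, Ideal.mul_mem_left _ _ (mem_leftAnnihilator_singleton.2 hxc)⟩, hr0⟩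
  obtain ⟨a, ⟨haI, hac⟩, ha0, ha⟩ := hG.exists_mul_self_mul_eq_zero hsp hne
  rw [SetLike.mem_coe, mem_leftAnnihilator_singleton] at hac
  have hann : ∀ t : R, t * (c + a) = 0 → t * c = 0 ∧ t * a = 0 := by
    intro t ht
    have htc : t * c = 0 := hc t (by
      have := congrArg (· * c) ht
      simpa only [mul_add, add_mul, mul_assoc, hac, mul_zero, add_zero, zero_mul] using this)
    exact ⟨htc, by rwa [mul_add, htc, zero_add] at ht⟩
  refine hmin (c + a) ⟨I.add_mem hcI haI, fun t ht => ?_⟩ ⟨fun t ht => ?_, a, ?_, ha0, fun r hr => ?_⟩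
  · obtain ⟨h1, h2⟩ := hann _ ht
    have htc : t * c = 0 := hc t (by
      simpa only [mul_add, add_mul, mul_assoc, hac, mul_zero, add_zero] using h1)
    have hta : t * a = 0 := ha t (by
      simpa only [mul_add, htc, zero_add] using h2)
    rw [mul_add, htc, hta, add_zero]
  · exact mem_leftAnnihilator_singleton.2 (hann t (mem_leftAnnihilator_singleton.1 ht)).1
  · exact mem_leftAnnihilator_singleton.2 hac
  · exact ha r (hann _ (mem_leftAnnihilator_singleton.1 hr)).2

/-- The left Ore condition. -/
theorem IsLeftGoldie.exists_mul_eq_mul (hG : IsLeftGoldie R) (hsp : IsSemiprimeRing R) (a : R)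
    {c : R} (hc : IsRegular c) : ∃ c' a' : R, IsRegular c' ∧ c' * a = a' * c := by
  obtain ⟨c', hc', hreg⟩ := hG.exists_isRegular_mem hsp
    ((hG.isEssential_span (isRegular_iff_mul_eq_zero.1 hc).2).colonRight a)
  obtain ⟨a', ha'⟩ := Ideal.mem_span_singleton'.1 (mem_colonRight.1 hc')
  exact ⟨c', a', hreg, ha'.symm⟩

/-- Let `x₀ = 1` and `xₙ₊₁ = φ(c xₙ)`. The annihilators `l(xₙ)` ascend, hence stabilize; essentiality
of `Rc` and injectivity of `φ` carry an equality `l(xₙ₊₁) = l(xₙ₊₂)` back to `l(xₙ) = l(xₙ₊₁)`, and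
so `l(φ(c)) = l(x₁) = l(x₀) = 0`. -/
theorem IsLeftGoldie.isRegular_map (hG : IsLeftGoldie R) (hsp : IsSemiprimeRing R)
    {φ : R →+* R} (hφ : Function.Injective φ) {c : R} (hc : IsRegular c) : IsRegular (φ c) := by
  obtain ⟨x, hx0, hxs⟩ : ∃ x : ℕ → R, x 0 = 1 ∧ ∀ n, x (n + 1) = φ (c * x n) :=
    ⟨fun n => Nat.rec 1 (fun _ y => φ (c * y)) n, rfl, fun _ => rfl⟩
  have hfac : ∀ n, ∃ y, x (n + 1) = x n * y := by
    intro n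
    induction n with
    | zero => exact ⟨x (0 + 1), by rw [hx0, one_mul]⟩
    | succ n ih =>
      obtain ⟨y, hy⟩ := ih
      exact ⟨φ y, by rw [hxs (n + 1), hy, ← mul_assoc, map_mul, ← hxs, hy]⟩
  have hback : ∀ n, (∀ t : R, t * x (n + 2) = 0 → t * x (n + 1) = 0) →
      ∀ t : R, t * x (n + 1) = 0 → t * x n = 0 := by
    intro n h t ht
    refine hG.eq_zero_of_essential_mul hsp
      ((hG.isEssential_span (isRegular_iff_mul_eq_zero.1 hc).2).colonRight t) fun r hr => ?_
    obtain ⟨d, hd⟩ := Ideal.mem_span_singleton'.1 (mem_colonRight.1 hr)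
    have h1 : φ d * x (n + 2) = 0 := by
      rw [hxs (n + 1), ← map_mul, ← mul_assoc, hd, mul_assoc, ht, mul_zero, map_zero]
    have h2 := h _ h1
    rw [hxs, ← map_mul, map_eq_zero_iff φ hφ, ← mul_assoc, hd] at h2
    rwa [← mul_assoc]
  have hzero : ∀ n, (∀ t : R, t * x (n + 1) = 0 → t * x n = 0) →
      ∀ t : R, t * x 1 = 0 → t * x 0 = 0 := by
    intro n
    induction n with
    | zero => exact id
    | succ n ih => exact fun h => ih (hback n h)
  obtain ⟨y, ⟨n, rfl⟩, hmax⟩ := hG.exists_maximal (fun y => ∃ n, y = x n) ⟨_, 0, rfl⟩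
  refine hG.isRegular_of_left hsp fun t ht => ?_
  have := hzero n (hmax (x (n + 1)) ⟨n + 1, rfl⟩ fun t ht => by
    obtain ⟨y, hy⟩ := hfac n
    rw [hy, ← mul_assoc, ht, zero_mul]) t (by rwa [← zero_add 1, hxs, hx0, mul_one])
  rwa [hx0, mul_one] at this

end Goldie

open OreLocalization nonZeroDivisors

/-! ### Classical left quotient rings -/

section Quotient

variable {R Q T S : Type*} [Ring R] [Ring Q] [Ring T] [Monoid S]

theorem isRegular_iff_mem {c : R} : IsRegular c ↔ c ∈ R⁰ :=
  isRegular_iff_mul_eq_zero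

theorem nonempty_oreSet
    (h : ∀ a c : R, IsRegular c → ∃ c' a' : R, IsRegular c' ∧ c' * a = a' * c) :
    Nonempty (OreSet R⁰) := by
  have h' : ∀ (a : R) (c : R⁰), ∃ (c' : R⁰) (a' : R), c' * a = a' * c := fun a c => by
    obtain ⟨c', a', hc', h⟩ := h a c (isRegular_iff_mem.2 c.2)
    exact ⟨⟨c', isRegular_iff_mem.1 hc'⟩, a', h⟩
  choose den num hden using h'
  exact ⟨{
    ore_right_cancel := fun r₁ r₂ s hs => ⟨1, by rw [(isRegular_iff_mem.2 s.2).right hs]⟩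
    oreNum := num
    oreDenom := den
    ore_eq := hden }⟩

theorem isClassicalLeftQuotientRing_numeratorRingHom [OreSet R⁰] :
    IsClassicalLeftQuotientRing (numeratorRingHom : R →+* R[R⁰⁻¹]) where
  injective := numeratorHom_inj inf_le_left
  isUnit c hc := numerator_isUnit ⟨c, isRegular_iff_mem.1 hc⟩
  exists_eq q := by
    induction q with | _ r s
    refine ⟨s, r, isRegular_iff_mem.2 s.2, ?_⟩
    exact OreLocalization.mul_cancel

/-- The universal property of the ring of left fractions. -/
theorem exists_lift [OreSet R⁰] (f : R →+* T) (hf : ∀ c : R, IsRegular c → IsUnit (f c)) :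
    ∃ g : R[R⁰⁻¹] →+* T, ∀ r : R, g (numeratorRingHom r) = f r := by
  have hf' : ∀ s : R⁰, IsUnit (f.toMonoidHom.comp R⁰.subtype s) :=
    fun s => hf s (isRegular_iff_mem.2 s.2)
  exact ⟨universalHom f (IsUnit.liftRight (f.toMonoidHom.comp R⁰.subtype) hf') fun _ => rfl,
    fun r => universalHom_commutes _ _ _⟩

/-- Homomorphisms from a classical left quotient ring are determined by their restrictions. -/
theorem IsClassicalLeftQuotientRing.hom_ext {k : R →+* Q} (hk : IsClassicalLeftQuotientRing k)
    {f g : Q →+* T} (h : ∀ r : R, f (k r) = g (k r)) : f = g := by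
  ext q
  obtain ⟨c, r, hc, hq⟩ := hk.exists_eq q
  refine ((hk.isUnit c hc).map f).mul_left_cancel ?_
  rw [← map_mul, hq, h c, ← map_mul, hq, h r]

/-- An embedding of `R` extends to an embedding of its classical left quotient ring. -/
theorem IsClassicalLeftQuotientRing.injective_of_comp {k : R →+* Q}
    (hk : IsClassicalLeftQuotientRing k) {g : Q →+* T} (h : Function.Injective (g.comp k)) :
    Function.Injective g := by
  rw [injective_iff_map_eq_zero]
  intro q hq
  obtain ⟨c, r, hc, hcq⟩ := hk.exists_eq q
  have hr : r = 0 := (map_eq_zero_iff (g.comp k) h).1 (by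
    rw [RingHom.comp_apply, ← hcq, map_mul, hq, mul_zero])
  rw [hr, map_zero] at hcq
  exact (hk.isUnit c hc).mul_right_eq_zero.1 hcq

theorem exists_extension_action [OreSet R⁰] (φ : S →* (R →+* R))
    (hφ : ∀ (s : S) (c : R), IsRegular c → IsRegular (φ s c)) :
    ∃ ψ : S →* (R[R⁰⁻¹] →+* R[R⁰⁻¹]),
      ∀ (s : S) (r : R), ψ s (numeratorRingHom r) = numeratorRingHom (φ s r) := by
  have hk := isClassicalLeftQuotientRing_numeratorRingHom (R := R)
  choose ψ hψ using fun s => exists_lift (numeratorRingHom.comp (φ s))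
    fun c hc => hk.isUnit _ (hφ s c hc)
  refine ⟨⟨⟨ψ, hk.hom_ext fun r => ?_⟩, fun s t => hk.hom_ext fun r => ?_⟩, hψ⟩
  · rw [hψ, map_one]; rfl
  · change ψ (s * t) (numeratorRingHom r) = ψ s (ψ t (numeratorRingHom r))
    rw [hψ, hψ, RingHom.comp_apply, RingHom.comp_apply, hψ, map_mul]; rfl

theorem IsRegular.map_ringEquiv {c : R} (hc : IsRegular c) (e : R ≃+* T) : IsRegular (e c) := by
  rw [isRegular_iff_mul_eq_zero] at hc ⊢
  refine ⟨fun r hr => ?_, fun r hr => ?_⟩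
  · rw [← map_eq_zero_iff e.symm e.symm.injective]
    exact hc.1 _ (by rw [← e.symm_apply_apply c, ← map_mul, hr, map_zero])
  · rw [← map_eq_zero_iff e.symm e.symm.injective]
    exact hc.2 _ (by rw [← e.symm_apply_apply c, ← map_mul, hr, map_zero])

theorem exists_extension_ringAut [OreSet R⁰] (α : S →* RingAut R) :
    ∃ ε : S →* RingAut R[R⁰⁻¹],
      ∀ (s : S) (r : R), ε s (numeratorRingHom r) = numeratorRingHom (α s r) := by
  -- Extending the action of the whole group `RingAut R` provides the inverses.
  obtain ⟨Ψ, hΨ⟩ := exists_extension_action (R := R) (S := RingAut R)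
    ⟨⟨fun g => g.toRingHom, rfl⟩, fun _ _ => rfl⟩ fun g c hc => IsRegular.map_ringEquiv hc g
  refine ⟨⟨⟨fun s => RingEquiv.ofRingHom (Ψ (α s)) (Ψ (α s)⁻¹) ?_ ?_, ?_⟩, fun s t => ?_⟩,
    fun s r => hΨ _ r⟩
  · rw [← RingHom.mul_def, ← map_mul, mul_inv_cancel, map_one]; rfl
  · rw [← RingHom.mul_def, ← map_mul, inv_mul_cancel, map_one]; rfl
  · ext x
    change Ψ (α 1) x = x
    rw [map_one, map_one]; rfl
  · ext x
    change Ψ (α (s * t)) x = Ψ (α s) (Ψ (α t) x)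
    rw [map_mul, map_mul]; rfl

end Quotient

/-! ### Cohn-Jordan extensions as directed unions -/

section CohnJordan

variable {S R A : Type*} [Monoid S] [Ring R] [Ring A] {φ : S →* (R →+* R)} {i : R →+* A}
  {α : S →* RingAut A}

/-- A monoid with a group of left quotients is left Ore. -/
theorem HasLeftQuotientGroup.exists_mul_eq_mul {S : Type v} [Monoid S]
    (hS : HasLeftQuotientGroup S) (s t : S) : ∃ s' t' : S, s' * s = t' * t := by
  obtain ⟨G, _, e, he, h⟩ := hS
  obtain ⟨t', s', h⟩ := h (e t * (e s)⁻¹)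
  refine ⟨s', t', he ?_⟩
  rw [eq_inv_mul_iff_mul_eq, ← mul_assoc, mul_inv_eq_iff_eq_mul] at h
  rw [map_mul, map_mul, h]

/-- `A` is the directed union of its subrings `α_m⁻¹(R)`. -/
theorem IsCohnJordanExtension.exists_common (hA : IsCohnJordanExtension φ i α)
    (hS : ∀ s t : S, ∃ s' t' : S, s' * s = t' * t) (a₁ a₂ : A) :
    ∃ (m : S) (b₁ b₂ : R), α m a₁ = i b₁ ∧ α m a₂ = i b₂ := by
  obtain ⟨s, c, rfl⟩ := hA.exists_eq a₁
  obtain ⟨t, d, rfl⟩ := hA.exists_eq a₂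
  obtain ⟨s', t', hst⟩ := hS s t
  refine ⟨s' * s, φ s' c, φ t' d, ?_, ?_⟩
  · rw [map_mul, RingAut.mul_apply, RingEquiv.apply_symm_apply, hA.extends_action]
  · rw [hst, map_mul, RingAut.mul_apply, RingEquiv.apply_symm_apply, hA.extends_action]

theorem IsCohnJordanExtension.isRegular_map (hA : IsCohnJordanExtension φ i α)
    (hφ : ∀ (s : S) (c : R), IsRegular c → IsRegular (φ s c)) {c : R} (hc : IsRegular c) :
    IsRegular (i c) := by
  rw [isRegular_iff_mul_eq_zero]
  refine ⟨fun x hx => ?_, fun x hx => ?_⟩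
  all_goals
    obtain ⟨m, b, rfl⟩ := hA.exists_eq x
    have hm := congrArg (α m) hx
    rw [map_mul, RingEquiv.apply_symm_apply, hA.extends_action, map_zero, ← map_mul,
      map_eq_zero_iff i hA.injective] at hm
  · rw [(isRegular_iff_mul_eq_zero.1 (hφ m c hc)).1 b hm, map_zero, map_zero]
  · rw [(isRegular_iff_mul_eq_zero.1 (hφ m c hc)).2 b hm, map_zero, map_zero]

theorem isRegular_of_map {f : R →+* A} (hf : Function.Injective f) {c : R}
    (hc : IsRegular (f c)) : IsRegular c := by
  rw [isRegular_iff_mul_eq_zero] at hc ⊢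
  refine ⟨fun r hr => ?_, fun r hr => ?_⟩
  · exact (map_eq_zero_iff f hf).1 (hc.1 _ (by rw [← map_mul, hr, map_zero]))
  · exact (map_eq_zero_iff f hf).1 (hc.2 _ (by rw [← map_mul, hr, map_zero]))

/-- The left Ore condition passes to a Cohn-Jordan extension. -/
theorem IsCohnJordanExtension.exists_mul_eq_mul (hA : IsCohnJordanExtension φ i α)
    (hS : ∀ s t : S, ∃ s' t' : S, s' * s = t' * t)
    (hφ : ∀ (s : S) (c : R), IsRegular c → IsRegular (φ s c))
    (hR : ∀ a c : R, IsRegular c → ∃ c' a' : R, IsRegular c' ∧ c' * a = a' * c)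
    (a t : A) (ht : IsRegular t) : ∃ t' a' : A, IsRegular t' ∧ t' * a = a' * t := by
  obtain ⟨m, b, c, hb, hc⟩ := hA.exists_common hS a t
  obtain ⟨c', b', hc', h⟩ := hR b c
    (isRegular_of_map hA.injective (by rw [← hc]; exact IsRegular.map_ringEquiv ht (α m)))
  refine ⟨(α m).symm (i c'), (α m).symm (i b'),
    IsRegular.map_ringEquiv (hA.isRegular_map hφ hc') _, (α m).injective ?_⟩
  rw [map_mul, map_mul, RingEquiv.apply_symm_apply, RingEquiv.apply_symm_apply, hb, hc, ← map_mul,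
    h, map_mul]

/-- The common over-ring is the ring of left fractions of `A`. It is a Cohn-Jordan extension of that
of `R`, since the numerator and the denominator of a fraction lie in a common `α_m⁻¹(R)`. -/
theorem exists_isCommonOverring {S : Type v} {R : Type u} {A : Type w} [Monoid S] [Ring R] [Ring A]
    {φ : S →* (R →+* R)} {i : R →+* A} {α : S →* RingAut A} (hA : IsCohnJordanExtension φ i α)
    (hS : ∀ s t : S, ∃ s' t' : S, s' * s = t' * t)
    (hφ : ∀ (s : S) (c : R), IsRegular c → IsRegular (φ s c))
    (hR : ∀ a c : R, IsRegular c → ∃ c' a' : R, IsRegular c' ∧ c' * a = a' * c) :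
    ∃ (Q : Type u) (E : Type w) (_ : Ring Q) (_ : Ring E) (k : R →+* Q) (ψ : S →* (Q →+* Q))
      (l : Q →+* E) (ε : S →* RingAut E) (j : A →+* E), IsCommonOverring φ i α k ψ l ε j := by
  obtain ⟨_⟩ := nonempty_oreSet hR
  obtain ⟨_⟩ := nonempty_oreSet (hA.exists_mul_eq_mul hS hφ hR)
  have hk := isClassicalLeftQuotientRing_numeratorRingHom (R := R)
  have hj := isClassicalLeftQuotientRing_numeratorRingHom (R := A)
  obtain ⟨ψ, hψ⟩ := exists_extension_action φ hφ
  obtain ⟨ε, hε⟩ := exists_extension_ringAut α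
  obtain ⟨l, hl⟩ := exists_lift ((numeratorRingHom : A →+* A[A⁰⁻¹]).comp i)
    fun c hc => hj.isUnit _ (hA.isRegular_map hφ hc)
  refine ⟨R[R⁰⁻¹], A[A⁰⁻¹], inferInstance, inferInstance, numeratorRingHom, ψ, l, ε,
    numeratorRingHom, hk, hψ, ⟨?_, fun s => ?_, fun x => ?_⟩, hj.injective, fun r => (hl r).symm,
    fun s a => (hε s a).symm⟩
  · refine hk.injective_of_comp ?_
    rw [show l.comp numeratorRingHom = numeratorRingHom.comp i from RingHom.ext hl]
    exact hj.injective.comp hA.injective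
  · refine fun q => DFunLike.congr_fun
      (hk.hom_ext (f := (ε s).toRingHom.comp l) (g := l.comp (ψ s)) fun r => ?_) q
    change ε s (l (numeratorRingHom r)) = l (ψ s (numeratorRingHom r))
    rw [hl, hψ, hl, RingHom.comp_apply, hε, hA.extends_action, RingHom.comp_apply]
  · obtain ⟨t, a, ht, hx⟩ := hj.exists_eq x
    obtain ⟨m, c, b, hc, hb⟩ := hA.exists_common hS t a
    have hcreg : IsRegular c := isRegular_of_map hA.injective (by
      rw [← hc]; exact IsRegular.map_ringEquiv ht (α m))
    obtain ⟨u, hu⟩ := hk.isUnit c hcreg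
    -- `x = t⁻¹ a` with `t = α_m⁻¹(c)` and `a = α_m⁻¹(b)`, hence `ε_m(x) = c⁻¹ b`.
    refine ⟨m, (↑u⁻¹ : R[R⁰⁻¹]) * numeratorRingHom b, (ε m).injective ?_⟩
    rw [RingEquiv.apply_symm_apply]
    refine ((hk.isUnit c hcreg).map l).mul_left_cancel ?_
    rw [← map_mul, ← hu, Units.mul_inv_cancel_left, hu, hl, hl, RingHom.comp_apply,
      RingHom.comp_apply, ← hc, ← hb, ← hε, ← hε, ← map_mul, hx]

end CohnJordan

/-! ### Closed principal one-sided ideals -/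

section Closure

variable {R A : Type*} [Ring R] [Ring A] {i : R →+* A} {c r : R}

theorem mem_rightClosure_principalRight :
    r ∈ rightClosure i (principalRight c) ↔ ∃ a : A, i r = i c * a := by
  refine ⟨fun h => ?_, fun ⟨a, ha⟩ => AddSubgroup.subset_closure ⟨c, ⟨1, (mul_one c).symm⟩, a, ha⟩⟩
  refine (AddSubgroup.closure_le (K := (AddMonoidHom.mulLeft (i c)).range)).2 ?_ h |>.imp
    fun a ha => ha.symm
  rintro _ ⟨_, ⟨s, rfl⟩, a, rfl⟩
  exact ⟨i s * a, by rw [map_mul i, mul_assoc]; rfl⟩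

theorem mem_leftClosure_principalLeft :
    r ∈ leftClosure i (principalLeft c) ↔ ∃ a : A, i r = a * i c := by
  refine ⟨fun h => ?_, fun ⟨a, ha⟩ => AddSubgroup.subset_closure ⟨a, c, ⟨1, (one_mul c).symm⟩, ha⟩⟩
  refine (AddSubgroup.closure_le (K := (AddMonoidHom.mulRight (i c)).range)).2 ?_ h |>.imp
    fun a ha => ha.symm
  rintro _ ⟨a, _, ⟨s, rfl⟩, rfl⟩
  exact ⟨a * i s, by rw [map_mul i, ← mul_assoc]; rfl⟩

end Closure

section Equivalence

variable {S R A Q E : Type*} [Monoid S] [Ring R] [Ring A] [Ring Q] [Ring E]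
  {φ : S →* (R →+* R)} {i : R →+* A} {α : S →* RingAut A} {k : R →+* Q} {ψ : S →* (Q →+* Q)}
  {l : Q →+* E} {ε : S →* RingAut E} {j : A →+* E}

/-- The conditions are compared inside the common over-ring, where a regular `c ∈ R` is invertible:
`c a = r` and `a c = r` say that `a = c⁻¹ r` and `a = r c⁻¹`, elements of `Q(R)`. -/
theorem IsCommonOverring.tfae (h : IsCommonOverring φ i α k ψ l ε j) :
    List.TFAE [
      Set.range l ∩ Set.range j = Set.range (j.comp i),
      ∀ c : R, IsRegular c →
        principalLeft c = leftClosure i (principalLeft c) ∧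
        principalRight c = rightClosure i (principalRight c),
      ∀ c : R, IsRegular c → principalRight c = rightClosure i (principalRight c),
      ∀ (a : A) (c : R), IsRegular c → i c * a ∈ Set.range i → a ∈ Set.range i] := by
  have hunit : ∀ c : R, IsRegular c → IsUnit (j (i c)) := fun c hc => by
    rw [h.agree]; exact (h.quotient.isUnit c hc).map l
  have hle : ∀ c : R, principalLeft c ⊆ leftClosure i (principalLeft c) := by
    rintro c _ ⟨r, rfl⟩
    exact mem_leftClosure_principalLeft.2 ⟨i r, map_mul i r c⟩
  have hre : ∀ c : R, principalRight c ⊆ rightClosure i (principalRight c) := by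
    rintro c _ ⟨r, rfl⟩
    exact mem_rightClosure_principalRight.2 ⟨i r, map_mul i c r⟩
  have hi : Function.Injective i := fun x y hxy => h.quotient.injective (h.cohnJordan.injective (by
    rw [← h.agree, ← h.agree, hxy]))
  have hmem : Set.range l ∩ Set.range j = Set.range (j.comp i) →
      ∀ a : A, j a ∈ Set.range l → a ∈ Set.range i := by
    intro h1 a ha
    obtain ⟨r, hr⟩ : j a ∈ Set.range (j.comp i) := h1 ▸ ⟨ha, a, rfl⟩
    exact ⟨r, h.injective hr⟩
  tfae_have 1 → 2 := by
    intro h1 c hc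
    obtain ⟨u, hu⟩ := h.quotient.isUnit c hc
    refine ⟨(hle c).antisymm fun r hr => ?_, (hre c).antisymm fun r hr => ?_⟩
    · obtain ⟨a, ha⟩ := mem_leftClosure_principalLeft.1 hr
      obtain ⟨r', rfl⟩ := hmem h1 a ⟨k r * ↑u⁻¹, (hunit c hc).mul_right_cancel (by
        rw [← map_mul, ← ha, h.agree, h.agree, ← map_mul, ← hu, Units.inv_mul_cancel_right])⟩
      exact ⟨r', hi (by rw [ha, map_mul])⟩
    · obtain ⟨a, ha⟩ := mem_rightClosure_principalRight.1 hr
      obtain ⟨r', rfl⟩ := hmem h1 a ⟨↑u⁻¹ * k r, (hunit c hc).mul_left_cancel (by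
        rw [← map_mul, ← ha, h.agree, h.agree, ← map_mul, ← hu, Units.mul_inv_cancel_left])⟩
      exact ⟨r', hi (by rw [ha, map_mul])⟩
  tfae_have 2 → 3 := fun h2 c hc => (h2 c hc).2
  tfae_have 3 → 4 := by
    rintro h3 a c hc ⟨r, hr⟩
    obtain ⟨r', rfl⟩ : r ∈ principalRight c := by
      rw [h3 c hc]; exact mem_rightClosure_principalRight.2 ⟨a, hr⟩
    refine ⟨r', h.injective ((hunit c hc).mul_left_cancel ?_)⟩
    rw [← map_mul, ← map_mul, hr, map_mul]
  tfae_have 4 → 1 := by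
    intro h4
    refine Set.Subset.antisymm ?_ ?_
    · rintro _ ⟨⟨q, hq⟩, a, rfl⟩
      obtain ⟨c, r, hc, hcq⟩ := h.quotient.exists_eq q
      obtain ⟨r', rfl⟩ := h4 a c hc ⟨r, h.injective (by
        rw [map_mul, ← hq, h.agree, h.agree, ← map_mul, hcq])⟩
      exact ⟨r', rfl⟩
    · rintro _ ⟨r, rfl⟩
      exact ⟨⟨k r, (h.agree r).symm⟩, i r, rfl⟩
  tfae_finish

end Equivalence

end CohnJordan

theorem mainTheorem8 {S : Type v} {R : Type u} {A : Type w} [Monoid S] [Ring R] [Ring A]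
    (hS : CohnJordan.HasLeftQuotientGroup S)
    (φ : S →* (R →+* R)) (hφ : ∀ s : S, Function.Injective (φ s))
    (i : R →+* A) (α : S →* RingAut A) (hA : CohnJordan.IsCohnJordanExtension φ i α)
    (hsemiprime : CohnJordan.IsSemiprimeRing R) (hGoldie : CohnJordan.IsLeftGoldie R) :
    (∃ (Q : Type u) (E : Type w) (_ : Ring Q) (_ : Ring E) (k : R →+* Q) (ψ : S →* (Q →+* Q))
      (l : Q →+* E) (ε : S →* RingAut E) (j : A →+* E),
      CohnJordan.IsCommonOverring φ i α k ψ l ε j) ∧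
    ∀ (Q : Type u') (E : Type w') [Ring Q] [Ring E] (k : R →+* Q) (ψ : S →* (Q →+* Q))
      (l : Q →+* E) (ε : S →* RingAut E) (j : A →+* E),
      CohnJordan.IsCommonOverring φ i α k ψ l ε j →
      List.TFAE [
        Set.range l ∩ Set.range j = Set.range (j.comp i),
        ∀ c : R, IsRegular c →
          CohnJordan.principalLeft c = CohnJordan.leftClosure i (CohnJordan.principalLeft c) ∧
          CohnJordan.principalRight c = CohnJordan.rightClosure i (CohnJordan.principalRight c),
        ∀ c : R, IsRegular c →
          CohnJordan.principalRight c = CohnJordan.rightClosure i (CohnJordan.principalRight c),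
        ∀ (a : A) (c : R), IsRegular c → i c * a ∈ Set.range i → a ∈ Set.range i] :=
  ⟨CohnJordan.exists_isCommonOverring hA hS.exists_mul_eq_mul
      (fun s _ hc => hGoldie.isRegular_map hsemiprime (hφ s) hc)
      (fun a _ hc => hGoldie.exists_mul_eq_mul hsemiprime a hc),
    fun _ _ _ _ _ _ _ _ _ h => h.tfae⟩
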